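/- For a countable, connected, locally finite graph $G$ and an integer $k\ge 0$, $k$-neighbour bootstrap percolation on $G$ starts from a random set of occupied vertices, each vertex being occupied independently with probability $p\in[0,1]$ (law $\mathbb P_p$); at each time step every vacant vertex with at least $k$ occupied neighbours becomes occupied, and occupied vertices stay occupied. Complete occupation is the event that every vertex eventually becomes occupied, and the critical probability is $$p(G,k)=\inf\{p\in[0,1] : \mathbb P_p(\text{complete occupation})>0\}.$$ Let $T_d$ denote the $(d+1)$-regular tree. 1. Let $2\le k\le d$. Then $p(T_d,k)$ is the supremum of all $p\in[0,1]$ for which the equation $$\mathbb P\bigl(\mathrm{Binom}(d,(1-x)(1-p))\le d-k\bigr)=x$$ has a real root $x\in(0,1)$. 2. For every $\gamma\in[0,1]$ and every sequence of nonnegative integers $k_d$ with $\lim_{d\to\infty}k_d/d=\gamma$, $$\lim_{d\to\infty}p(T_d,k_d)=\gamma.$$ 3. For every $d\ge 2$, $$p(T_d,d)=1-\frac1d\qquad\text{and}\qquad p(T_d,2)=1-\frac{(d-1)^{2d-3}}{d^{d-1}(d-2)^{d-2}}$$ (with $0^0=1$ when $d=2$), and $p(T_d,2)\sim\dfrac{1}{2d^2}$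 as $d\to\infty$. -/

import Mathlib

open Set Filter Topology MeasureTheory ProbabilityTheory unitInterval Asymptotics

noncomputable section

/-- One time step of `k`-neighbour bootstrap percolation on `G`: occupied sites stay occupied, and
a vacant site with at least `k` occupied neighbours becomes occupied. -/
def bootstrapStep {V : Type*} (G : SimpleGraph V) (k : ℕ) (A : Set V) : Set V :=
  A ∪ {v | (k : ℕ∞) ≤ (G.neighborSet v ∩ A).encard}

/-- Complete occupation from the initially occupied set `A`: every vertex becomes occupied after
finitely many time steps. -/
def CompleteOccupation {V : Type*} (G : SimpleGraph V) (k : ℕ) (A : Set V) : Prop :=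
  ∀ v : V, ∃ n : ℕ, v ∈ (bootstrapStep G k)^[n] A

/-- The critical probability of the `k`-neighbour rule on `G`: the infimum of the `p ∈ [0,1]` for
which complete occupation has positive probability, when every site is initially occupied with
probability `p`, independently (`setBernoulli univ p` is the law of that random set of sites). -/
def criticalProbability {V : Type*} (G : SimpleGraph V) (k : ℕ) : ℝ :=
  sInf ((fun p : I ↦ (p : ℝ)) '' {p : I | 0 < setBernoulli (univ : Set V) p
    {A : Set V | CompleteOccupation G k A}})

/-- The `(d+1)`-regular tree. Vertices of the rooted `d`-ary tree are lists over `Fin d`, where the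
children of `l` are the lists `a :: l`; two copies of it, with their roots joined by an edge, form
the `(d+1)`-regular tree. -/
def regularTree (d : ℕ) : SimpleGraph (Bool × List (Fin d)) :=
  SimpleGraph.fromRel fun u v ↦
    (u = (false, []) ∧ v = (true, [])) ∨ ∃ a : Fin d, v = (u.1, a :: u.2)

end

theorem regularTree_neighborSet_nil (d : ℕ) (b : Bool) :
    (regularTree d).neighborSet (b, []) =
      insert (!b, []) (range fun a : Fin d ↦ (b, [a])) := by
  ext ⟨c, l⟩
  cases b <;> cases c <;> rcases l with _ | ⟨a, l⟩ <;>
    simp [regularTree, SimpleGraph.mem_neighborSet, eq_comm]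

theorem regularTree_neighborSet_cons (d : ℕ) (b : Bool) (a : Fin d) (l : List (Fin d)) :
    (regularTree d).neighborSet (b, a :: l) =
      insert (b, l) (range fun c : Fin d ↦ (b, c :: a :: l)) := by
  ext ⟨c, m⟩
  simp only [regularTree, SimpleGraph.mem_neighborSet, SimpleGraph.fromRel_adj, Prod.mk.injEq,
    mem_insert_iff, mem_range]
  constructor
  · rintro ⟨-, (⟨⟨-, h⟩, -⟩ | ⟨e, rfl, rfl⟩) | (⟨-, -, h⟩ | ⟨e, h1, h2⟩)⟩
    · simp at h
    · exact Or.inr ⟨e, rfl, rfl⟩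
    · simp at h
    · simp only [List.cons.injEq] at h2
      exact Or.inl ⟨h1.symm, h2.2.symm⟩
  · rintro (⟨rfl, rfl⟩ | ⟨e, rfl, rfl⟩)
    · exact ⟨by simp, Or.inr (Or.inr ⟨a, rfl, rfl⟩)⟩
    · exact ⟨by simp, Or.inl (Or.inr ⟨e, rfl, rfl⟩)⟩

/-- Every vertex of `regularTree d` has exactly `d + 1` neighbours. -/
theorem regularTree_encard_neighborSet (d : ℕ) (v : Bool × List (Fin d)) :
    ((regularTree d).neighborSet v).encard = d + 1 := by
  obtain ⟨b, _ | ⟨a, l⟩⟩ := v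
  · rw [regularTree_neighborSet_nil, encard_insert_of_notMem (by simp),
      ← image_univ, Function.Injective.encard_image]
    · simp
    · intro x y h
      simpa using h
  · rw [regularTree_neighborSet_cons, encard_insert_of_notMem, ← image_univ,
      Function.Injective.encard_image]
    · simp
    · intro x y h
      simpa using h
    · rintro ⟨c, h⟩
      have := congrArg (fun u : Bool × List (Fin d) ↦ u.2.length) h
      simp at this
      omega

/-- `regularTree d` is a tree. -/
theorem regularTree_isTree (d : ℕ) : (regularTree d).IsTree := by
  have par : ∀ v u w : Bool × List (Fin d), (regularTree d).Adj v u → (regularTree d).Adj v w →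
      u.2.length ≤ v.2.length → w.2.length ≤ v.2.length → u = w := by
    rintro ⟨b, _ | ⟨a, l⟩⟩ u w hu hw h1 h2
    · rw [← SimpleGraph.mem_neighborSet, regularTree_neighborSet_nil] at hu hw
      rcases hu with rfl | ⟨x, rfl⟩ <;> rcases hw with rfl | ⟨y, rfl⟩ <;> simp_all
    · rw [← SimpleGraph.mem_neighborSet, regularTree_neighborSet_cons] at hu hw
      rcases hu with rfl | ⟨x, rfl⟩ <;> rcases hw with rfl | ⟨y, rfl⟩ <;> simp_all
  have reach : ∀ (l : List (Fin d)) (b : Bool), (regularTree d).Reachable (b, l) (true, []) := by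
    intro l
    induction l with
    | nil =>
      rintro (_ | _)
      · refine SimpleGraph.Adj.reachable ?_
        rw [← SimpleGraph.mem_neighborSet, regularTree_neighborSet_nil]
        simp
      · exact SimpleGraph.Reachable.refl _
    | cons a l ih =>
      intro b
      refine (SimpleGraph.Adj.reachable ?_).trans (ih b)
      rw [← SimpleGraph.mem_neighborSet, regularTree_neighborSet_cons]
      simp
  refine ⟨⟨fun u v ↦ (reach u.2 u.1).trans (reach v.2 v.1).symm⟩, ?_⟩
  intro v c hc
  classical
  obtain ⟨u, hu, hmax⟩ := c.support.toFinset.exists_max_image (fun u ↦ u.2.length)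
    ⟨v, by simp⟩
  have hu' : u ∈ c.support := by simpa using hu
  have hc' := hc.rotate hu'
  have hm : ∀ w ∈ (c.rotate u hu').support, w.2.length ≤ u.2.length := by
    intro w hw
    exact hmax w (by simpa [SimpleGraph.Walk.mem_support_rotate_iff] using hw)
  have hn : ¬ (c.rotate u hu').Nil := hc'.not_nil
  exact hc'.snd_ne_penultimate (par u _ _ ((c.rotate u hu').adj_snd hn)
    ((c.rotate u hu').adj_penultimate hn).symm
    (hm _ ((c.rotate u hu').getVert_mem_support _)) (hm _ ((c.rotate u hu').getVert_mem_support _)))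

/-! A site that stays vacant forever has at most `k - 1` children that ever become occupied, hence
at least `m = d + 1 - k` children that stay vacant forever. It is therefore the root of an infinite
vacant subtree with `m` children at every site. Conversely, a non-root site of such a subtree has a
vacant parent and at most `d - m < k` occupied children, so it can never be occupied. Only the root
is exposed from above; requiring all `d` of its children to carry such subtrees protects it, since
`k ≥ 2` and its upper neighbour alone cannot occupy it (`InFort.notMem_iterate`).

Branches of distinct children are independent, so the probability that the subtree reaches depth `n`
is the `n`-th iterate at 1 of `f(y) = (1-p) P(Binom(d,y) ≥ m)`, which is `branchMap`. If `y ≤ f(y)`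
for some `y ∈ (0,1]`, the iterates stay above `y`, a protected root has positive probability, and
among the `d^j` independent sites of generation `j` one occurs with probability tending to 1:
complete occupation is null. If `f(y) < y` throughout `(0,1]`, the iterates tend to 0 and complete
occupation is almost sure.

The theorem is thereby reduced to comparing `f(y)` with `y`. Positive fixed points correspond to
roots of the stated equation through `y = (1-x)(1-p)`. Markov and Chebyshev bounds on the binomial
tail give the limit `γ`. For `k = d` Markov's bound is sharp, and for `k = 2` the tail divided by
`y` can be maximised explicitly. -/

/-! ### Independence of events on disjoint sets of sites -/

/-- The σ-algebra on sets of sites generated by the occupation of the sites in `S`. -/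
@[reducible] def coordSigma {V : Type*} (S : Set V) : MeasurableSpace (Set V) :=
  ⨆ v ∈ S, MeasurableSpace.comap (fun A : Set V ↦ v ∈ A) ⊤

theorem coordSigma_mono {V : Type*} {S T : Set V} (h : S ⊆ T) : coordSigma S ≤ coordSigma T :=
  biSup_mono h

theorem coordSigma_le {V : Type*} (S : Set V) : coordSigma S ≤ Set.instMeasurableSpace := by
  refine iSup₂_le fun v _ ↦ ?_
  have : Measurable fun A : Set V ↦ v ∈ A := measurable_set_mem v
  exact this.comap_le

theorem measurableSet_coordSigma {V : Type*} {S : Set V} {v : V} (hv : v ∈ S) :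
    MeasurableSet[coordSigma S] {A : Set V | v ∉ A} := by
  have h : MeasurableSpace.comap (fun A : Set V ↦ v ∈ A) ⊤ ≤ coordSigma S :=
    le_iSup₂_of_le v hv le_rfl
  exact h _ ⟨{False}, trivial, by ext A; simp⟩

theorem setBernoulli_map_mem {V : Type*} (p : I) :
    (setBernoulli (univ : Set V) p).map (fun A v ↦ v ∈ A) = Measure.infinitePi (fun _ : V ↦
      toNNReal p • Measure.dirac True + toNNReal (σ p) • Measure.dirac False) := by
  rw [setBernoulli_eq_map, Measure.map_map]
  · simp [Function.comp_def]
  · exact measurable_pi_iff.2 fun v ↦ measurable_set_mem v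
  · exact MeasurableEquiv.setOfPred.measurable

theorem setBernoulli_map_eval {V : Type*} (p : I) (v : V) :
    (setBernoulli (univ : Set V) p).map (fun A ↦ v ∈ A) =
      toNNReal p • Measure.dirac True + toNNReal (σ p) • Measure.dirac False := by
  have h := congrArg (Measure.map (fun f : V → Prop ↦ f v)) (setBernoulli_map_mem (V := V) p)
  rw [Measure.map_map (by fun_prop) (measurable_pi_iff.2 fun v ↦ measurable_set_mem v),
    Measure.infinitePi_map_eval] at h
  exact h

theorem iIndepFun_setBernoulli {V : Type*} (p : I) :
    iIndepFun (fun (v : V) (A : Set V) ↦ v ∈ A) (setBernoulli univ p) := by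
  rw [iIndepFun_iff_map_fun_eq_infinitePi_map (fun v ↦ measurable_set_mem v),
    setBernoulli_map_mem]
  congr 1
  ext1 v
  rw [setBernoulli_map_eval]

theorem setBernoulli_real_notMem {V : Type*} (p : I) (v : V) :
    (setBernoulli (univ : Set V) p).real {A | v ∉ A} = 1 - p := by
  have h := congrArg (fun ν : Measure Prop ↦ ν.real {False}) (setBernoulli_map_eval p v)
  rw [map_measureReal_apply (measurable_set_mem v) trivial] at h
  have e : (fun A : Set V ↦ v ∈ A) ⁻¹' {False} = {A | v ∉ A} := by ext; simp
  rw [e] at h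
  rw [h]
  simp [measureReal_def]

theorem indep_coordSigma {V : Type*} (p : I) {S T : Set V} (h : Disjoint S T) :
    Indep (coordSigma S) (coordSigma T) (setBernoulli univ p) :=
  indep_iSup_of_disjoint
    (fun v ↦ Measurable.comap_le (measurable_set_mem v))
    (iIndepFun_setBernoulli p).iIndep h

/-- Peel off one index at a time: its block is disjoint from the union of the remaining blocks. -/
theorem iIndepSet_of_coordSigma {V ι : Type*} (p : I) {S : ι → Set V}
    (hS : Pairwise (Function.onFun Disjoint S)) {E : ι → Set (Set V)}
    (hE : ∀ i, MeasurableSet[coordSigma (S i)] (E i)) :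
    iIndepSet E (setBernoulli univ p) := by
  classical
  rw [iIndepSet_iff_meas_biInter fun i ↦ coordSigma_le _ _ (hE i)]
  intro s
  induction s using Finset.induction_on with
  | empty => simp
  | insert i s hi ih =>
    rw [Finset.prod_insert hi, ← ih, Finset.set_biInter_insert]
    have hd : Disjoint (S i) (⋃ j ∈ s, S j) := by
      rw [disjoint_iUnion₂_right]
      exact fun j hj ↦ hS fun h ↦ hi (h ▸ hj)
    refine (Indep_iff _ _ _).1 (indep_coordSigma p hd) _ _ (hE i) ?_
    refine Finset.measurableSet_biInter s fun j hj ↦ ?_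
    exact coordSigma_mono (subset_biUnion_of_mem (u := S) (Finset.mem_coe.2 hj)) _ (hE j)

theorem measurableSet_le_ncard {Ω ι : Type*} [MeasurableSpace Ω] [Countable ι] {E : ι → Set Ω}
    (hE : ∀ c, MeasurableSet (E c)) (m : ℕ) : MeasurableSet {ω | m ≤ {c | ω ∈ E c}.ncard} := by
  have h1 : Measurable (fun ω ↦ {c | ω ∈ E c}) :=
    measurable_set_iff.2 fun c ↦ measurable_mem.2 (hE c)
  have h2 : Measurable (ncard : Set ι → ℕ) := by fun_prop
  exact (h2.comp h1) (measurableSet_Ici (a := m))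

/-- The number of events that occur among `d` independent events of probability `y` is binomial. -/
theorem measureReal_ncard_eq_binomial {Ω : Type*} [MeasurableSpace Ω] {μ : Measure Ω}
    [IsProbabilityMeasure μ] {d : ℕ} {E : Fin d → Set Ω} (hm : ∀ c, MeasurableSet (E c))
    (hE : iIndepSet E μ) {y : I} (hy : ∀ c, μ.real (E c) = y) (m : ℕ) :
    μ.real {ω | m ≤ {c | ω ∈ E c}.ncard} = (binomial d y).real (Ici m) := by
  have hX : ∀ c, Measurable fun ω ↦ ω ∈ E c := fun c ↦ measurable_mem.2 (hm c)
  have hXi : iIndepFun (fun c ω ↦ ω ∈ E c) μ := hE.iIndep_comap_mem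
  -- The random set of indices whose events occur is a Bernoulli random subset of `Fin d`; its
  -- cardinality is then binomial.
  have hlaw : μ.map (fun ω ↦ {c | ω ∈ E c}) = setBernoulli (univ : Set (Fin d)) y := by
    have h1 := hXi.map_fun_eq_infinitePi_map hX
    have h2 : ∀ c, μ.map (fun ω ↦ ω ∈ E c) =
        toNNReal y • Measure.dirac True + toNNReal (σ y) • Measure.dirac False := by
      intro c
      have hT : μ.real ((fun ω ↦ ω ∈ E c) ⁻¹' {True}) = y := by
        rw [← hy c]
        congr 1
        ext ω
        simp
      have hF : μ.real ((fun ω ↦ ω ∈ E c) ⁻¹' {False}) = 1 - y := by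
        rw [← hy c, ← probReal_compl_eq_one_sub (hm c)]
        congr 1
        ext ω
        simp
      have := Measure.isProbabilityMeasure_map (μ := μ) (hX c).aemeasurable
      refine Measure.ext_of_measureReal_singleton fun q ↦ ?_
      rw [map_measureReal_apply (hX c) trivial]
      by_cases hq : q
      · rw [eq_true hq, hT]
        simp [measureReal_def]
      · rw [eq_false hq, hF]
        simp [measureReal_def]
    simp_rw [h2] at h1
    rw [setBernoulli_eq_map]
    simp only [mem_univ]
    rw [← h1]
    exact (Measure.map_map (g := fun p : Fin d → Prop ↦ {i | p i})
      (MeasurableEquiv.setOfPred.measurable) (measurable_pi_iff.2 hX)).symm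
  have hms : Measurable (fun ω ↦ {c | ω ∈ E c}) := by
    exact measurable_set_iff.2 hX
  have e : (binomial d y) = (setBernoulli (univ : Set (Fin d)) y).map ncard := by
    refine Measure.ext_of_measureReal_singleton fun k ↦ ?_
    rw [binomial_real_singleton, map_ncard_setBernoulli_real_singleton finite_univ]
    simp [ncard_univ]
  rw [e, map_measureReal_apply (by fun_prop) (by measurability), ← hlaw,
    map_measureReal_apply hms]
  · rfl
  · exact (show Measurable (ncard : Set (Fin d) → ℕ) by fun_prop) (by measurability)

/-! ### Binomial tails as polynomials -/

/-- The probability that a binomial variable with parameters `d` and `y` is at least `m`, as a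
polynomial function of `y`. -/
noncomputable def binomialTail (d m : ℕ) (y : ℝ) : ℝ :=
  1 - ∑ j ∈ Finset.range m, (bernsteinPolynomial ℝ d j).eval y

theorem bernsteinPolynomial_eval (d j : ℕ) (y : ℝ) :
    (bernsteinPolynomial ℝ d j).eval y = d.choose j * y ^ j * (1 - y) ^ (d - j) := by
  simp [bernsteinPolynomial]

theorem bernsteinPolynomial_eval_nonneg (d j : ℕ) {y : ℝ} (h0 : 0 ≤ y) (h1 : y ≤ 1) :
    0 ≤ (bernsteinPolynomial ℝ d j).eval y := by
  have : 0 ≤ 1 - y := by linarith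
  rw [bernsteinPolynomial_eval]
  positivity

theorem binomial_real_Iio (d m : ℕ) (y : I) :
    (binomial d y).real (Iio m) =
      ∑ j ∈ Finset.range m, (bernsteinPolynomial ℝ d j).eval (y : ℝ) := by
  have : (Iio m : Set ℕ) = (Finset.range m : Set ℕ) := by ext; simp
  rw [this, ← sum_measureReal_singleton]
  refine Finset.sum_congr rfl fun j _ ↦ ?_
  rw [binomial_real_singleton, bernsteinPolynomial_eval]

theorem binomial_real_Ici (d m : ℕ) (y : I) :
    (binomial d y).real (Ici m) = binomialTail d m y := by
  rw [binomialTail, ← binomial_real_Iio, ← probReal_compl_eq_one_sub measurableSet_Iio, compl_Iio]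

theorem binomial_real_Iic (d n : ℕ) (y : I) :
    (binomial d y).real (Iic n) = 1 - binomialTail d (n + 1) y := by
  rw [binomialTail, ← binomial_real_Iio, sub_sub_cancel]
  congr 1
  ext j
  simp

theorem binomialTail_eq_sum {d m : ℕ} (hm : m ≤ d + 1) (y : ℝ) :
    binomialTail d m y = ∑ j ∈ Finset.Ico m (d + 1), (bernsteinPolynomial ℝ d j).eval y := by
  have h := congrArg (Polynomial.eval y) (bernsteinPolynomial.sum ℝ d)
  rw [Polynomial.eval_finsetSum, Polynomial.eval_one] at h
  rw [binomialTail, ← h, Finset.sum_Ico_eq_sub _ hm]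

theorem binomialTail_le_one (d m : ℕ) {y : ℝ} (h0 : 0 ≤ y) (h1 : y ≤ 1) :
    binomialTail d m y ≤ 1 := by
  rw [binomialTail, sub_le_self_iff]
  exact Finset.sum_nonneg fun j _ ↦ bernsteinPolynomial_eval_nonneg d j h0 h1

theorem binomialTail_nonneg (d m : ℕ) {y : ℝ} (h0 : 0 ≤ y) (h1 : y ≤ 1) :
    0 ≤ binomialTail d m y := by
  have := binomial_real_Ici d m ⟨y, h0, h1⟩
  rw [← this]
  positivity

theorem continuous_binomialTail (d m : ℕ) : Continuous (binomialTail d m) :=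
  continuous_const.sub (continuous_finsetSum _ fun _ _ ↦ Polynomial.continuous _)

/-- Derivatives of Bernstein polynomials are differences of consecutive ones of degree `d - 1`, so
the sum telescopes to one nonnegative term. Monotonicity of the tail follows. -/
theorem hasDerivAt_binomialTail (d m : ℕ) (y : ℝ) :
    HasDerivAt (binomialTail d (m + 1))
      (d * (bernsteinPolynomial ℝ (d - 1) m).eval y) y := by
  induction m with
  | zero =>
    have h := ((bernsteinPolynomial ℝ d 0).hasDerivAt y).const_sub 1
    rw [bernsteinPolynomial.derivative_zero] at h
    have e : binomialTail d (0 + 1) = fun x ↦ 1 - (bernsteinPolynomial ℝ d 0).eval x := by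
      ext x; simp [binomialTail]
    rw [e]
    refine h.congr_deriv ?_
    simp
  | succ m ih =>
    have h := ih.sub ((bernsteinPolynomial ℝ d (m + 1)).hasDerivAt y)
    rw [bernsteinPolynomial.derivative_succ] at h
    have e : binomialTail d (m + 1 + 1) =
        binomialTail d (m + 1) - fun x ↦ (bernsteinPolynomial ℝ d (m + 1)).eval x := by
      ext x
      simp only [binomialTail, Pi.sub_apply]
      rw [Finset.sum_range_succ _ (m + 1)]
      ring
    rw [e]
    refine h.congr_deriv ?_
    simp
    ring

theorem monotoneOn_binomialTail (d m : ℕ) : MonotoneOn (binomialTail d m) (Icc 0 1) := by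
  cases m with
  | zero => intro x _ y _ _; simp [binomialTail]
  | succ m =>
    refine monotoneOn_of_deriv_nonneg (convex_Icc 0 1) (continuous_binomialTail d _).continuousOn
      (fun y _ ↦ (hasDerivAt_binomialTail d m y).differentiableAt.differentiableWithinAt) ?_
    intro y hy
    rw [interior_Icc] at hy
    rw [(hasDerivAt_binomialTail d m y).deriv]
    have := bernsteinPolynomial_eval_nonneg (d - 1) m hy.1.le hy.2.le
    positivity

/-! ### Vacant subtrees and forts -/

/-- The random sets `A` for which the branch at the site `v` contains, to depth `n`, a subtree of
vacant sites rooted at `v` each of which has at least `m` children in the subtree. -/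
def vacantSubtree (d m : ℕ) : ℕ → Bool × List (Fin d) → Set (Set (Bool × List (Fin d)))
  | 0, _ => univ
  | n + 1, v => {A | v ∉ A} ∩ {A | m ≤ {c | A ∈ vacantSubtree d m n (v.1, c :: v.2)}.ncard}

theorem vacantSubtree_succ (d m n : ℕ) (v : Bool × List (Fin d)) :
    vacantSubtree d m (n + 1) v =
      {A | v ∉ A} ∩ {A | m ≤ {c | A ∈ vacantSubtree d m n (v.1, c :: v.2)}.ncard} := rfl

theorem vacantSubtree_succ_subset (d m n : ℕ) (v : Bool × List (Fin d)) :
    vacantSubtree d m (n + 1) v ⊆ vacantSubtree d m n v := by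
  induction n generalizing v with
  | zero => exact subset_univ _
  | succ n ih =>
    rintro A ⟨h1, h2⟩
    exact ⟨h1, (show m ≤ _ from h2).trans (ncard_le_ncard fun c hc ↦ ih _ hc)⟩

theorem antitone_vacantSubtree (d m : ℕ) (v : Bool × List (Fin d)) :
    Antitone fun n ↦ vacantSubtree d m n v :=
  antitone_nat_of_succ_le fun n ↦ vacantSubtree_succ_subset d m n v

/-- The random sets `A` for which the branch at `v` contains an infinite subtree of vacant sites
rooted at `v` each of which has at least `m` children in the subtree. -/
def infiniteVacantSubtree (d m : ℕ) (v : Bool × List (Fin d)) : Set (Set (Bool × List (Fin d))) :=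
  ⋂ n, vacantSubtree d m n v

/-- Compactness: a decreasing sequence of subsets of a finite type stabilises. This passes from
subtrees of every finite depth to infinite ones. -/
theorem le_ncard_iInter_of_antitone {α : Type*} [Finite α] {S : ℕ → Set α} (hS : Antitone S)
    {m : ℕ} (h : ∀ n, m ≤ (S n).ncard) : m ≤ (⋂ n, S n).ncard := by
  have : ∀ a : α, ∃ n, a ∈ S n → a ∈ ⋂ n, S n := by
    intro a
    by_cases ha : a ∈ ⋂ n, S n
    · exact ⟨0, fun _ ↦ ha⟩
    · simp only [mem_iInter, not_forall] at ha
      obtain ⟨n, hn⟩ := ha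
      exact ⟨n, fun h ↦ absurd h hn⟩
  choose N hN using this
  obtain ⟨M, hM⟩ := (Set.finite_range N).bddAbove
  exact (h M).trans (ncard_le_ncard fun a ha ↦ hN a (hS (hM (mem_range_self a)) ha))

theorem notMem_of_mem_infiniteVacantSubtree {d m : ℕ} {v : Bool × List (Fin d)}
    {A : Set (Bool × List (Fin d))} (h : A ∈ infiniteVacantSubtree d m v) : v ∉ A :=
  (mem_iInter.1 h 1).1

theorem le_ncard_children_of_mem_infiniteVacantSubtree {d m : ℕ} {v : Bool × List (Fin d)}
    {A : Set (Bool × List (Fin d))} (h : A ∈ infiniteVacantSubtree d m v) :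
    m ≤ {c | A ∈ infiniteVacantSubtree d m (v.1, c :: v.2)}.ncard := by
  have e : {c | A ∈ infiniteVacantSubtree d m (v.1, c :: v.2)} =
      ⋂ n, {c | A ∈ vacantSubtree d m n (v.1, c :: v.2)} := by
    ext c
    simp [infiniteVacantSubtree]
  rw [e]
  refine le_ncard_iInter_of_antitone (fun a b hab c hc ↦ ?_) fun n ↦ (mem_iInter.1 h (n + 1)).2
  exact antitone_vacantSubtree d m _ hab hc

/-- The random sets `A` for which the site `v` is vacant and every child of `v` is the root of an
infinite vacant subtree. -/
def fortRoot (d m : ℕ) (v : Bool × List (Fin d)) : Set (Set (Bool × List (Fin d))) :=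
  {A | v ∉ A} ∩ ⋂ c : Fin d, infiniteVacantSubtree d m (v.1, c :: v.2)

/-- The sites joined to `v` by a path of descendants of `v` that are roots of infinite vacant
subtrees. -/
inductive InFort (d m : ℕ) (A : Set (Bool × List (Fin d))) (v : Bool × List (Fin d)) :
    Bool × List (Fin d) → Prop
  | root : InFort d m A v v
  | child (w : Bool × List (Fin d)) (c : Fin d) (hw : InFort d m A v w)
      (hc : A ∈ infiniteVacantSubtree d m (w.1, c :: w.2)) : InFort d m A v (w.1, c :: w.2)

/-! ### Forts against the bootstrap dynamics -/

theorem bootstrapStep_iterate_succ {V : Type*} (G : SimpleGraph V) (k n : ℕ) (A : Set V) :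
    (bootstrapStep G k)^[n + 1] A = (bootstrapStep G k)^[n] A ∪
      {v | (k : ℕ∞) ≤ (G.neighborSet v ∩ (bootstrapStep G k)^[n] A).encard} := by
  rw [Function.iterate_succ_apply']
  rfl

theorem monotone_bootstrapStep_iterate {V : Type*} (G : SimpleGraph V) (k : ℕ) (A : Set V) :
    Monotone fun n ↦ (bootstrapStep G k)^[n] A :=
  monotone_nat_of_le_succ fun n ↦ by
    rw [bootstrapStep_iterate_succ]
    exact subset_union_left

/-- Induction on time, for all sites of the fort at once: no site can be the first to become
occupied. -/
theorem InFort.notMem_iterate {d m k : ℕ} {A : Set (Bool × List (Fin d))}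
    {v : Bool × List (Fin d)} (hk : 2 ≤ k) (hm : d < m + k) (hv : A ∈ fortRoot d m v) (n : ℕ)
    {w : Bool × List (Fin d)} (hw : InFort d m A v w) :
    w ∉ (bootstrapStep (regularTree d) k)^[n] A := by
  induction n generalizing w with
  | zero =>
    cases hw with
    | root => exact hv.1
    | child w c _ hc => exact notMem_of_mem_infiniteVacantSubtree hc
  | succ n ih =>
    rw [bootstrapStep_iterate_succ]
    rintro (h | h)
    · exact ih hw h
    refine absurd h (not_le.2 (?_ : _ < (k : ℕ∞)))
    cases hw with
    | root =>
      obtain ⟨b, l⟩ := v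
      have hch : ∀ c : Fin d, (b, c :: l) ∉ (bootstrapStep (regularTree d) k)^[n] A :=
        fun c ↦ ih (InFort.child _ c InFort.root (mem_iInter.1 hv.2 c))
      -- The exceptional neighbour `u` is the parent, or the root of the other copy when `l = []`.
      have hsub : ∃ u, (regularTree d).neighborSet (b, l) ∩
          (bootstrapStep (regularTree d) k)^[n] A ⊆ {u} := by
        cases l with
        | nil =>
          refine ⟨(!b, []), ?_⟩
          rw [regularTree_neighborSet_nil]
          rintro u ⟨rfl | ⟨c, rfl⟩, hu⟩
          · rfl
          · exact absurd hu (hch c)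
        | cons a l =>
          refine ⟨(b, l), ?_⟩
          rw [regularTree_neighborSet_cons]
          rintro u ⟨rfl | ⟨c, rfl⟩, hu⟩
          · rfl
          · exact absurd hu (hch c)
      obtain ⟨u, hu⟩ := hsub
      refine (encard_le_encard hu).trans_lt ?_
      rw [encard_singleton]
      exact_mod_cast hk
    | child w c hw hc =>
      have hw' := ih hw
      obtain ⟨b, l⟩ := w
      have hcard := le_ncard_children_of_mem_infiniteVacantSubtree hc
      dsimp only at hcard
      set S := {e : Fin d | A ∈ infiniteVacantSubtree d m (b, e :: c :: l)} with hS
      have hsub : (regularTree d).neighborSet (b, c :: l) ∩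
          (bootstrapStep (regularTree d) k)^[n] A ⊆ (fun e : Fin d ↦ (b, e :: c :: l)) '' Sᶜ := by
        rw [regularTree_neighborSet_cons]
        rintro u ⟨rfl | ⟨e, rfl⟩, hu⟩
        · exact absurd hu hw'
        · refine ⟨e, fun he ↦ ?_, rfl⟩
          have hfort : InFort d m A v (b, c :: l) := InFort.child (b, l) c hw hc
          have hfort' : InFort d m A v (b, e :: c :: l) := InFort.child (b, c :: l) e hfort he
          exact ih hfort' hu
      refine (encard_le_encard hsub).trans_lt ((encard_image_le _ _).trans_lt ?_)
      rw [← Set.Finite.cast_ncard_eq (toFinite _)]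
      have := ncard_add_ncard_compl S
      rw [Nat.card_fin] at this
      exact_mod_cast (by omega : Sᶜ.ncard < k)

theorem CompleteOccupation.notMem_fortRoot {d m k : ℕ} {A : Set (Bool × List (Fin d))}
    (h : CompleteOccupation (regularTree d) k A) (hk : 2 ≤ k) (hm : d < m + k)
    (v : Bool × List (Fin d)) : A ∉ fortRoot d m v := by
  intro hv
  obtain ⟨n, hn⟩ := h v
  exact InFort.root.notMem_iterate hk hm hv n hn

/-- With finitely many neighbours, all those ever occupied are occupied at a common time; `k` of
them would then occupy `v` one step later. -/
theorem encard_neighborSet_inter_lt_of_forall_notMem {V : Type*} {G : SimpleGraph V} {k : ℕ}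
    {A : Set V} {v : V} (hf : (G.neighborSet v).Finite)
    (hv : ∀ n, v ∉ (bootstrapStep G k)^[n] A) :
    (G.neighborSet v ∩ ⋃ n, (bootstrapStep G k)^[n] A).encard < k := by
  set O := fun n ↦ (bootstrapStep G k)^[n] A with hO
  have hmono : Monotone O := monotone_bootstrapStep_iterate G k A
  obtain ⟨n, hn⟩ : ∃ n, G.neighborSet v ∩ ⋃ n, O n ⊆ O n := by
    have h : ∀ u, ∃ n, u ∈ ⋃ n, O n → u ∈ O n := by
      intro u
      by_cases hu : u ∈ ⋃ n, O n
      · obtain ⟨n, hn⟩ := mem_iUnion.1 hu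
        exact ⟨n, fun _ ↦ hn⟩
      · exact ⟨0, fun h ↦ absurd h hu⟩
    choose N hN using h
    obtain ⟨M, hM⟩ := (hf.image N).bddAbove
    exact ⟨M, fun u hu ↦ hmono (hM (mem_image_of_mem N hu.1)) (hN u hu.2)⟩
  by_contra! h
  refine hv (n + 1) ?_
  rw [bootstrapStep_iterate_succ]
  exact Or.inr (h.trans (encard_le_encard fun u hu ↦ ⟨hu.1, hn hu⟩))

theorem regularTree_child_mem_neighborSet {d : ℕ} (v : Bool × List (Fin d)) (c : Fin d) :
    (v.1, c :: v.2) ∈ (regularTree d).neighborSet v := by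
  obtain ⟨b, _ | ⟨a, l⟩⟩ := v
  · rw [regularTree_neighborSet_nil]
    exact Or.inr ⟨c, rfl⟩
  · rw [regularTree_neighborSet_cons]
    exact Or.inr ⟨c, rfl⟩

theorem regularTree_finite_neighborSet (d : ℕ) (v : Bool × List (Fin d)) :
    ((regularTree d).neighborSet v).Finite := by
  rw [← encard_lt_top_iff, regularTree_encard_neighborSet]
  exact_mod_cast ENat.natCast_lt_top (d + 1)

theorem mem_vacantSubtree_of_forall_notMem {d k : ℕ} {A : Set (Bool × List (Fin d))} (n : ℕ)
    {v : Bool × List (Fin d)} (hv : ∀ t, v ∉ (bootstrapStep (regularTree d) k)^[t] A) :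
    A ∈ vacantSubtree d (d + 1 - k) n v := by
  induction n generalizing v with
  | zero => trivial
  | succ n ih =>
    refine ⟨hv 0, ?_⟩
    set S := {c : Fin d | ∀ t, (v.1, c :: v.2) ∉ (bootstrapStep (regularTree d) k)^[t] A} with hS
    have hsub : S ⊆ {c | A ∈ vacantSubtree d (d + 1 - k) n (v.1, c :: v.2)} := fun c hc ↦ ih hc
    refine le_trans ?_ (ncard_le_ncard hsub)
    have h1 := encard_neighborSet_inter_lt_of_forall_notMem
      (regularTree_finite_neighborSet d v) hv
    have h2 : (fun c : Fin d ↦ (v.1, c :: v.2)) '' Sᶜ ⊆ (regularTree d).neighborSet v ∩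
        ⋃ t, (bootstrapStep (regularTree d) k)^[t] A := by
      rintro _ ⟨c, hc, rfl⟩
      refine ⟨regularTree_child_mem_neighborSet v c, ?_⟩
      simpa [hS] using hc
    have h3 := (encard_le_encard h2).trans_lt h1
    rw [Function.Injective.encard_image (fun a b h ↦ by simpa using h),
      ← Set.Finite.cast_ncard_eq (toFinite _)] at h3
    have h4 : Sᶜ.ncard < k := by exact_mod_cast h3
    have := ncard_add_ncard_compl S
    rw [Nat.card_fin] at this
    omega

/-! ### Survival probabilities of vacant subtrees -/

/-- The sites of the branch at `v`: the site `v` and its descendants. -/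
def branch {d : ℕ} (v : Bool × List (Fin d)) : Set (Bool × List (Fin d)) :=
  {u | u.1 = v.1 ∧ v.2 <:+ u.2}

theorem self_mem_branch {d : ℕ} (v : Bool × List (Fin d)) : v ∈ branch v :=
  ⟨rfl, List.suffix_refl _⟩

theorem branch_child_subset {d : ℕ} (v : Bool × List (Fin d)) (c : Fin d) :
    branch (v.1, c :: v.2) ⊆ branch v :=
  fun _ hu ↦ ⟨hu.1, (List.suffix_cons c v.2).trans hu.2⟩

theorem notMem_branch_child {d : ℕ} (v : Bool × List (Fin d)) (c : Fin d) :
    v ∉ branch (v.1, c :: v.2) := by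
  rintro ⟨-, h⟩
  have := h.length_le
  simp at this

theorem pairwise_disjoint_branch_child {d : ℕ} (v : Bool × List (Fin d)) :
    Pairwise (Function.onFun Disjoint fun c : Fin d ↦ branch (v.1, c :: v.2)) := by
  intro a b hab
  refine Set.disjoint_left.2 fun u hu hu' ↦ hab ?_
  have h := List.suffix_of_suffix_length_le hu.2 hu'.2 (by simp)
  have := h.eq_of_length (by simp)
  simpa using this

theorem disjoint_singleton_iUnion_branch_child {d : ℕ} (v : Bool × List (Fin d)) :
    Disjoint {v} (⋃ c : Fin d, branch (v.1, c :: v.2)) := by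
  rw [disjoint_singleton_left, mem_iUnion, not_exists]
  exact notMem_branch_child v

theorem measurableSet_vacantSubtree (d m n : ℕ) (v : Bool × List (Fin d)) :
    MeasurableSet[coordSigma (branch v)] (vacantSubtree d m n v) := by
  induction n generalizing v with
  | zero => exact MeasurableSet.univ
  | succ n ih =>
    refine MeasurableSet.inter (measurableSet_coordSigma (self_mem_branch v)) ?_
    exact @measurableSet_le_ncard _ _ (coordSigma (branch v)) _ _
      (fun c ↦ coordSigma_mono (branch_child_subset v c) _ (ih _)) m

theorem measurableSet_infiniteVacantSubtree (d m : ℕ) (v : Bool × List (Fin d)) :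
    MeasurableSet[coordSigma (branch v)] (infiniteVacantSubtree d m v) :=
  MeasurableSet.iInter fun n ↦ measurableSet_vacantSubtree d m n v

theorem measurableSet_fortRoot (d m : ℕ) (v : Bool × List (Fin d)) :
    MeasurableSet[coordSigma (branch v)] (fortRoot d m v) :=
  (measurableSet_coordSigma (self_mem_branch v)).inter <| MeasurableSet.iInter fun c ↦
    coordSigma_mono (branch_child_subset v c) _ (measurableSet_infiniteVacantSubtree d m _)

/-- The probability that a vacant subtree survives one more generation, given the probability `y`
that it survives in each of the `d` child branches. -/
noncomputable def branchMap (d m : ℕ) (p y : ℝ) : ℝ := (1 - p) * binomialTail d m y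

theorem setBernoulli_real_notMem_inter {d : ℕ} (p : I) (v : Bool × List (Fin d))
    {F : Set (Set (Bool × List (Fin d)))}
    (hF : MeasurableSet[coordSigma (⋃ c : Fin d, branch (v.1, c :: v.2))] F) :
    (setBernoulli univ p).real ({A | v ∉ A} ∩ F) = (1 - p) * (setBernoulli univ p).real F := by
  have h := (Indep_iff _ _ _).1
    (indep_coordSigma p (disjoint_singleton_iUnion_branch_child v)) {A | v ∉ A} F
    (measurableSet_coordSigma (mem_singleton v)) hF
  rw [← setBernoulli_real_notMem p v]
  simp only [measureReal_def, h, ENNReal.toReal_mul]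

theorem setBernoulli_real_vacantSubtree (d m n : ℕ) (p : I) (v : Bool × List (Fin d)) :
    (setBernoulli univ p).real (vacantSubtree d m n v) = (branchMap d m p)^[n] 1 := by
  induction n generalizing v with
  | zero => simp [vacantSubtree]
  | succ n ih =>
    rw [vacantSubtree_succ, setBernoulli_real_notMem_inter, Function.iterate_succ_apply',
      ← ih v]
    · have hy : (setBernoulli univ p).real (vacantSubtree d m n v) ∈ I :=
        ⟨measureReal_nonneg, measureReal_le_one⟩
      have h := measureReal_ncard_eq_binomial (μ := setBernoulli univ p) (y := ⟨_, hy⟩)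
        (fun c ↦ coordSigma_le _ _ (measurableSet_vacantSubtree d m n (v.1, c :: v.2)))
        (iIndepSet_of_coordSigma p (pairwise_disjoint_branch_child v)
          fun c ↦ measurableSet_vacantSubtree d m n (v.1, c :: v.2))
        (fun c ↦ by rw [ih, ← ih v]) m
      rw [h, binomial_real_Ici]
      rfl
    · exact @measurableSet_le_ncard _ _ (coordSigma _) _ _
        (fun c ↦ coordSigma_mono (subset_iUnion (fun c ↦ branch (v.1, c :: v.2)) c) _
          (measurableSet_vacantSubtree d m n _)) m

theorem branchMap_mem_Icc (d m : ℕ) (p : I) {y : ℝ} (hy : y ∈ Icc (0 : ℝ) 1) :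
    branchMap d m p y ∈ Icc (0 : ℝ) 1 := by
  have h1 := binomialTail_nonneg d m hy.1 hy.2
  have h2 := binomialTail_le_one d m hy.1 hy.2
  have h3 : (0 : ℝ) ≤ 1 - p := sub_nonneg.2 p.2.2
  have h4 : (1 : ℝ) - p ≤ 1 := sub_le_self _ p.2.1
  exact ⟨mul_nonneg h3 h1, mul_le_one₀ h4 h1 h2⟩

theorem branchMap_mono (d m : ℕ) (p : I) {x y : ℝ} (hx : 0 ≤ x) (hxy : x ≤ y) (hy : y ≤ 1) :
    branchMap d m p x ≤ branchMap d m p y :=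
  mul_le_mul_of_nonneg_left
    (monotoneOn_binomialTail d m ⟨hx, hxy.trans hy⟩ ⟨hx.trans hxy, hy⟩ hxy) (sub_nonneg.2 p.2.2)

theorem branchMap_iterate_mem_Icc (d m n : ℕ) (p : I) :
    (branchMap d m p)^[n] 1 ∈ Icc (0 : ℝ) 1 := by
  induction n with
  | zero => simp
  | succ n ih =>
    rw [Function.iterate_succ_apply']
    exact branchMap_mem_Icc d m p ih

/-- By monotonicity a point with `y ≤ f(y)` is a barrier for the iterates from 1; it need not be a
fixed point. -/
theorem le_branchMap_iterate (d m n : ℕ) (p : I) {y : ℝ} (hy : y ∈ Icc (0 : ℝ) 1)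
    (h : y ≤ branchMap d m p y) : y ≤ (branchMap d m p)^[n] 1 := by
  induction n with
  | zero => exact hy.2
  | succ n ih =>
    rw [Function.iterate_succ_apply']
    exact h.trans (branchMap_mono d m p hy.1 ih (branchMap_iterate_mem_Icc d m n p).2)

theorem continuous_branchMap (d m : ℕ) (p : ℝ) : Continuous (branchMap d m p) :=
  continuous_const.mul (continuous_binomialTail d m)

/-- The iterates decrease to a fixed point of a continuous map, and 0 is the only candidate left. -/
theorem tendsto_branchMap_iterate (d m : ℕ) (p : I)
    (h : ∀ y : ℝ, 0 < y → y ≤ 1 → branchMap d m p y < y) :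
    Tendsto (fun n ↦ (branchMap d m p)^[n] 1) atTop (𝓝 0) := by
  have hmem := fun n ↦ branchMap_iterate_mem_Icc d m n p
  have hanti : Antitone fun n ↦ (branchMap d m p)^[n] 1 := by
    refine antitone_nat_of_succ_le fun n ↦ ?_
    induction n with
    | zero => exact (hmem 1).2
    | succ n ih =>
      rw [Function.iterate_succ_apply' _ (n + 1), Function.iterate_succ_apply' _ n]
      rw [Function.iterate_succ_apply' _ n] at ih
      exact branchMap_mono d m p (branchMap_mem_Icc d m p (hmem n)).1 ih (hmem n).2
  have hlim := tendsto_atTop_ciInf hanti ⟨0, by rintro _ ⟨n, rfl⟩; exact (hmem n).1⟩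
  set L := ⨅ n, (branchMap d m p)^[n] 1
  have hL : L ∈ Icc (0 : ℝ) 1 := isClosed_Icc.mem_of_tendsto hlim (Eventually.of_forall hmem)
  have hfix : branchMap d m p L = L :=
    isFixedPt_of_tendsto_iterate hlim (continuous_branchMap d m p).continuousAt
  rcases hL.1.eq_or_lt with h0 | h0
  · rwa [← h0] at hlim
  · exact absurd hfix (h L h0 hL.2).ne

theorem le_setBernoulli_real_infiniteVacantSubtree {d m : ℕ} {p : I} {y : ℝ}
    (hy : y ∈ Icc (0 : ℝ) 1) (h : y ≤ branchMap d m p y) (v : Bool × List (Fin d)) :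
    y ≤ (setBernoulli univ p).real (infiniteVacantSubtree d m v) := by
  have ht := tendsto_measure_iInter_atTop (μ := setBernoulli (univ : Set (Bool × List (Fin d))) p)
    (s := fun n ↦ vacantSubtree d m n v)
    (fun n ↦ (coordSigma_le _ _ (measurableSet_vacantSubtree d m n v)).nullMeasurableSet)
    (antitone_vacantSubtree d m v) ⟨0, measure_ne_top _ _⟩
  have ht' := (ENNReal.tendsto_toReal (measure_ne_top _ _)).comp ht
  refine ge_of_tendsto' ht' fun n ↦ ?_
  exact (le_branchMap_iterate d m n p hy h).trans_eq (setBernoulli_real_vacantSubtree d m n p v).symm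

theorem le_setBernoulli_real_fortRoot {d m : ℕ} {p : I} {y : ℝ}
    (hy : y ∈ Icc (0 : ℝ) 1) (h : y ≤ branchMap d m p y) (v : Bool × List (Fin d)) :
    (1 - p) * y ^ d ≤ (setBernoulli univ p).real (fortRoot d m v) := by
  rw [fortRoot, setBernoulli_real_notMem_inter]
  · refine mul_le_mul_of_nonneg_left ?_ (sub_nonneg.2 p.2.2)
    have hi := iIndepSet_of_coordSigma p (pairwise_disjoint_branch_child v)
      fun c ↦ measurableSet_infiniteVacantSubtree d m (v.1, c :: v.2)
    have := hi.meas_biInter Finset.univ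
    simp only [Finset.mem_univ, iInter_true] at this
    rw [measureReal_def, this, ENNReal.toReal_prod]
    calc y ^ d = ∏ _c : Fin d, y := by simp
      _ ≤ _ := Finset.prod_le_prod (fun _ _ ↦ hy.1)
        fun c _ ↦ le_setBernoulli_real_infiniteVacantSubtree hy h (v.1, c :: v.2)
  · exact MeasurableSet.iInter fun c ↦
      coordSigma_mono (subset_iUnion (fun c ↦ branch (v.1, c :: v.2)) c) _
        (measurableSet_infiniteVacantSubtree d m _)

/-! ### Dichotomy: complete occupation is null or has positive probability -/

/-- The random sets for which no descendant of `v` of generation `j` is a fort root. -/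
def noFortRoot (d m : ℕ) : ℕ → Bool × List (Fin d) → Set (Set (Bool × List (Fin d)))
  | 0, v => (fortRoot d m v)ᶜ
  | j + 1, v => ⋂ c : Fin d, noFortRoot d m j (v.1, c :: v.2)

theorem measurableSet_noFortRoot (d m j : ℕ) (v : Bool × List (Fin d)) :
    MeasurableSet[coordSigma (branch v)] (noFortRoot d m j v) := by
  induction j generalizing v with
  | zero => exact (measurableSet_fortRoot d m v).compl
  | succ j ih =>
    exact MeasurableSet.iInter fun c ↦ coordSigma_mono (branch_child_subset v c) _ (ih _)

/-- The `d ^ j` descendants of generation `j` have disjoint branches, so their fort events are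
independent. -/
theorem setBernoulli_real_noFortRoot_le {d m : ℕ} {p : I} {s : ℝ}
    (h : ∀ v, s ≤ (setBernoulli univ p).real (fortRoot d m v)) (j : ℕ)
    (v : Bool × List (Fin d)) :
    (setBernoulli univ p).real (noFortRoot d m j v) ≤ (1 - s) ^ d ^ j := by
  induction j generalizing v with
  | zero =>
    rw [noFortRoot, probReal_compl_eq_one_sub (coordSigma_le _ _ (measurableSet_fortRoot d m v))]
    have := h v
    rw [pow_zero, pow_one]
    linarith
  | succ j ih =>
    have hi := iIndepSet_of_coordSigma p (pairwise_disjoint_branch_child v)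
      fun c ↦ measurableSet_noFortRoot d m j (v.1, c :: v.2)
    have := hi.meas_biInter Finset.univ
    simp only [Finset.mem_univ, iInter_true] at this
    rw [noFortRoot, measureReal_def, this, ENNReal.toReal_prod, pow_succ, pow_mul]
    calc _ ≤ ∏ _c : Fin d, (1 - s) ^ d ^ j :=
          Finset.prod_le_prod (fun _ _ ↦ ENNReal.toReal_nonneg) fun c _ ↦ ih _
      _ = _ := by simp

theorem CompleteOccupation.mem_noFortRoot {d m k : ℕ} {A : Set (Bool × List (Fin d))}
    (h : CompleteOccupation (regularTree d) k A) (hk : 2 ≤ k) (hm : d < m + k) (j : ℕ)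
    (v : Bool × List (Fin d)) : A ∈ noFortRoot d m j v := by
  induction j generalizing v with
  | zero => exact h.notMem_fortRoot hk hm v
  | succ j ih => exact mem_iInter.2 fun c ↦ ih _

theorem setBernoulli_completeOccupation_eq_zero {d k : ℕ} (hd : 2 ≤ d) (hk : 2 ≤ k) {p : I} {y : ℝ}
    (h0 : 0 < y) (h1 : y ≤ 1) (h : y ≤ branchMap d (d + 1 - k) p y) :
    setBernoulli univ p {A | CompleteOccupation (regularTree d) k A} = 0 := by
  set m := d + 1 - k
  have hp : (0 : ℝ) < 1 - p := by
    refine (sub_nonneg.2 p.2.2).lt_of_ne fun hp ↦ ?_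
    rw [branchMap, ← hp, zero_mul] at h
    exact h0.not_ge h
  set s : ℝ := (1 - p) * y ^ d with hs
  have hs0 : 0 < s := by positivity
  have hfort := fun v ↦ le_setBernoulli_real_fortRoot (p := p) ⟨h0.le, h1⟩ h v
  have hs1 : s ≤ 1 := (hfort (true, [])).trans measureReal_le_one
  have ht : Tendsto (fun j ↦ (1 - s) ^ d ^ j) atTop (𝓝 0) :=
    (tendsto_pow_atTop_nhds_zero_of_lt_one (by linarith) (by linarith)).comp
      (tendsto_pow_atTop_atTop_of_one_lt (by omega))
  have hle : ∀ j : ℕ, (setBernoulli univ p).real {A | CompleteOccupation (regularTree d) k A} ≤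
      (1 - s) ^ d ^ j := fun j ↦
    (measureReal_mono fun A hA ↦
      CompleteOccupation.mem_noFortRoot hA hk (by omega) j (true, [])).trans
      (setBernoulli_real_noFortRoot_le hfort j (true, []))
  have := ge_of_tendsto' ht hle
  have := le_antisymm this measureReal_nonneg
  rwa [measureReal_eq_zero_iff] at this

theorem setBernoulli_completeOccupation_pos {d k : ℕ} {p : I}
    (h : ∀ y : ℝ, 0 < y → y ≤ 1 → branchMap d (d + 1 - k) p y < y) :
    0 < setBernoulli univ p {A | CompleteOccupation (regularTree d) k A} := by
  set m := d + 1 - k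
  have hnull : ∀ v, setBernoulli univ p (infiniteVacantSubtree d m v) = 0 := by
    intro v
    have hle : ∀ n, (setBernoulli univ p).real (infiniteVacantSubtree d m v) ≤
        (branchMap d m p)^[n] 1 := fun n ↦
      (measureReal_mono (iInter_subset _ n)).trans_eq (setBernoulli_real_vacantSubtree d m n p v)
    have := le_antisymm (ge_of_tendsto' (tendsto_branchMap_iterate d m p h) hle) measureReal_nonneg
    rwa [measureReal_eq_zero_iff] at this
  have hc : setBernoulli univ p {A | CompleteOccupation (regularTree d) k A}ᶜ = 0 := by
    refine measure_mono_null ?_ (measure_iUnion_null hnull)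
    intro A hA
    simp only [CompleteOccupation, mem_compl_iff, mem_ofPred_eq, not_forall, not_exists] at hA
    obtain ⟨v, hv⟩ := hA
    exact mem_iUnion.2 ⟨v, mem_iInter.2 fun n ↦ mem_vacantSubtree_of_forall_notMem n hv⟩
  refine pos_iff_ne_zero.2 fun h0 ↦ ?_
  -- Subadditivity suffices here, so measurability of complete occupation is never needed.
  have h1 := measure_union_le (μ := setBernoulli univ p)
    {A | CompleteOccupation (regularTree d) k A} {A | CompleteOccupation (regularTree d) k A}ᶜ
  rw [union_compl_self, measure_univ, h0, hc] at h1
  simp at h1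

/-! ### Criteria bounding the critical probability -/

theorem criticalProbability_le {V : Type*} {G : SimpleGraph V} {k : ℕ} {p : I}
    (h : 0 < setBernoulli (univ : Set V) p {A : Set V | CompleteOccupation G k A}) :
    criticalProbability G k ≤ p :=
  csInf_le ⟨0, by rintro _ ⟨q, -, rfl⟩; exact q.2.1⟩ ⟨p, h, rfl⟩

theorem setBernoulli_one_completeOccupation_pos {V : Type*} [Countable V] (G : SimpleGraph V)
    (k : ℕ) : 0 < setBernoulli (univ : Set V) 1 {A : Set V | CompleteOccupation G k A} := by
  rw [setBernoulli_one]
  have h : (univ : Set V) ∈ {A : Set V | CompleteOccupation G k A} := fun v ↦ ⟨0, mem_univ v⟩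
  rw [Measure.dirac_apply_of_mem h]
  exact zero_lt_one

theorem criticalProbability_nonneg {V : Type*} (G : SimpleGraph V) (k : ℕ) :
    0 ≤ criticalProbability G k :=
  Real.sInf_nonneg (by rintro _ ⟨q, -, rfl⟩; exact q.2.1)

theorem criticalProbability_le_one {V : Type*} [Countable V] (G : SimpleGraph V) (k : ℕ) :
    criticalProbability G k ≤ 1 :=
  criticalProbability_le (setBernoulli_one_completeOccupation_pos G k)

theorem criticalProbability_regularTree_le {d k : ℕ} {p : ℝ} (hp0 : 0 ≤ p) (hp1 : p ≤ 1)
    (h : ∀ y : ℝ, 0 < y → y ≤ 1 → branchMap d (d + 1 - k) p y < y) :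
    criticalProbability (regularTree d) k ≤ p :=
  criticalProbability_le (p := ⟨p, hp0, hp1⟩) (setBernoulli_completeOccupation_pos h)

/-- `branchMap` decreases in `p`, so every `q < p` inherits the inequality and has null complete
occupation. -/
theorem le_criticalProbability_regularTree {d k : ℕ} (hd : 2 ≤ d) (hk : 2 ≤ k) {p y : ℝ}
    (h0 : 0 < y) (h1 : y ≤ 1) (h : y ≤ branchMap d (d + 1 - k) p y) :
    p ≤ criticalProbability (regularTree d) k := by
  refine le_csInf ⟨_, 1, setBernoulli_one_completeOccupation_pos _ k, rfl⟩ ?_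
  rintro _ ⟨q, hq, rfl⟩
  by_contra! hqp
  refine hq.ne' (setBernoulli_completeOccupation_eq_zero hd hk h0 h1 (h.trans ?_))
  exact mul_le_mul_of_nonneg_right (by linarith) (binomialTail_nonneg _ _ h0.le h1)

/-- Markov's inequality for the binomial distribution. -/
theorem mul_binomialTail_le {d m : ℕ} (hm : m ≤ d + 1) {y : ℝ} (h0 : 0 ≤ y) (h1 : y ≤ 1) :
    m * binomialTail d m y ≤ d * y := by
  have h := congrArg (Polynomial.eval y) (bernsteinPolynomial.sum_smul ℝ d)
  simp only [Polynomial.eval_finsetSum, Polynomial.eval_X,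
    nsmul_eq_mul, Polynomial.eval_mul, Polynomial.eval_natCast] at h
  rw [binomialTail_eq_sum hm, ← h, Finset.mul_sum]
  calc ∑ j ∈ Finset.Ico m (d + 1), (m : ℝ) * (bernsteinPolynomial ℝ d j).eval y
      ≤ ∑ j ∈ Finset.Ico m (d + 1), (j : ℝ) * (bernsteinPolynomial ℝ d j).eval y := by
        refine Finset.sum_le_sum fun j hj ↦ ?_
        have hj' : (m : ℝ) ≤ j := by exact_mod_cast (Finset.mem_Ico.1 hj).1
        exact mul_le_mul_of_nonneg_right hj' (bernsteinPolynomial_eval_nonneg d j h0 h1)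
    _ ≤ _ := by
        refine Finset.sum_le_sum_of_subset_of_nonneg (fun j hj ↦ ?_) fun j _ _ ↦ ?_
        · exact Finset.mem_range.2 (Finset.mem_Ico.1 hj).2
        · exact mul_nonneg (Nat.cast_nonneg j) (bernsteinPolynomial_eval_nonneg d j h0 h1)

/-- Chebyshev's inequality for the binomial distribution. -/
theorem sq_mul_one_sub_binomialTail_le {d m : ℕ} {y : ℝ} (h0 : 0 ≤ y) (h1 : y ≤ 1)
    (hm : (m : ℝ) ≤ d * y) : (d * y - m) ^ 2 * (1 - binomialTail d m y) ≤ d := by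
  have h := congrArg (Polynomial.eval y) (bernsteinPolynomial.variance ℝ d)
  simp only [Polynomial.eval_finsetSum, Polynomial.eval_X, Polynomial.eval_pow,
    nsmul_eq_mul, Polynomial.eval_mul, Polynomial.eval_natCast, Polynomial.eval_sub,
    Polynomial.eval_one] at h
  have hmd : m ≤ d := by
    have : (m : ℝ) ≤ d := hm.trans (mul_le_of_le_one_right (Nat.cast_nonneg d) h1)
    exact_mod_cast this
  rw [binomialTail, sub_sub_cancel, Finset.mul_sum]
  calc ∑ j ∈ Finset.range m, (d * y - m) ^ 2 * (bernsteinPolynomial ℝ d j).eval y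
      ≤ ∑ j ∈ Finset.range m, (d * y - j) ^ 2 * (bernsteinPolynomial ℝ d j).eval y := by
        refine Finset.sum_le_sum fun j hj ↦ ?_
        have hj' : (j : ℝ) ≤ m := by exact_mod_cast (Finset.mem_range.1 hj).le
        refine mul_le_mul_of_nonneg_right ?_ (bernsteinPolynomial_eval_nonneg d j h0 h1)
        exact pow_le_pow_left₀ (by linarith) (by linarith) 2
    _ ≤ ∑ j ∈ Finset.range (d + 1), (d * y - j) ^ 2 * (bernsteinPolynomial ℝ d j).eval y := by
        refine Finset.sum_le_sum_of_subset_of_nonneg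
          (Finset.range_mono (by omega)) fun j _ _ ↦ ?_
        exact mul_nonneg (sq_nonneg _) (bernsteinPolynomial_eval_nonneg d j h0 h1)
    _ = d * y * (1 - y) := h
    _ ≤ d := by
        have : (0 : ℝ) ≤ d := Nat.cast_nonneg d
        have h2 : y * (1 - y) ≤ 1 := by nlinarith
        nlinarith

/-- Markov's bound gives `f(y) ≤ (1-p) d y / m < y`; the strict hypothesis also forces `m > 0`. -/
theorem criticalProbability_regularTree_le_of_lt {d k : ℕ} {p : ℝ} (hp0 : 0 ≤ p)
    (hp1 : p ≤ 1) (h : (1 - p) * d < (d + 1 - k : ℕ)) :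
    criticalProbability (regularTree d) k ≤ p := by
  refine criticalProbability_regularTree_le hp0 hp1 fun y h0 h1 ↦ ?_
  have hm : d + 1 - k ≤ d + 1 := by omega
  set m := d + 1 - k
  have hM := mul_binomialTail_le hm h0.le h1
  have hm0 : (0 : ℝ) < m := (mul_nonneg (sub_nonneg.2 hp1) (Nat.cast_nonneg d)).trans_lt h
  have h2 : m * branchMap d m p y ≤ (1 - p) * (d * y) := by
    rw [branchMap, mul_left_comm]
    exact mul_le_mul_of_nonneg_left hM (sub_nonneg.2 hp1)
  have h3 : (1 - p) * (d * y) < m * y := by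
    rw [← mul_assoc]
    exact mul_lt_mul_of_pos_right h h0
  exact lt_of_mul_lt_mul_left (h2.trans_lt h3) hm0.le

theorem binomialTail_lt_one {d m : ℕ} (hm : 0 < m) {y : ℝ} (h0 : 0 ≤ y) (h1 : y < 1) :
    binomialTail d m y < 1 := by
  rw [binomialTail, sub_lt_self_iff]
  refine Finset.sum_pos' (fun j _ ↦ bernsteinPolynomial_eval_nonneg d j h0 h1.le)
    ⟨0, Finset.mem_range.2 hm, ?_⟩
  have : 0 < 1 - y := sub_pos.2 h1
  rw [bernsteinPolynomial_eval]
  simp only [Nat.choose_zero_right, pow_zero, Nat.cast_one, mul_one, one_mul]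
  positivity

theorem binomialTail_antitone {d m n : ℕ} (hmn : m ≤ n) {y : ℝ} (h0 : 0 ≤ y) (h1 : y ≤ 1) :
    binomialTail d n y ≤ binomialTail d m y :=
  sub_le_sub_left (Finset.sum_le_sum_of_subset_of_nonneg (Finset.range_mono hmn)
    fun j _ _ ↦ bernsteinPolynomial_eval_nonneg d j h0 h1) 1

theorem binomialTail_one (d : ℕ) (y : ℝ) : binomialTail d 1 y = 1 - (1 - y) ^ d := by
  simp [binomialTail, bernsteinPolynomial_eval]

theorem binomialTail_pred (n : ℕ) (y : ℝ) :
    binomialTail (n + 2) (n + 1) y = y * (y ^ n * ((n + 2) - (n + 1) * y)) := by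
  rw [binomialTail_eq_sum (by omega), Finset.sum_Ico_succ_top (by omega),
    Finset.sum_Ico_succ_top (by omega), Finset.Ico_self, Finset.sum_empty]
  simp only [bernsteinPolynomial_eval, Nat.choose_self, Nat.choose_succ_self_right]
  rw [show n + 2 - (n + 1) = 1 by omega, Nat.sub_self]
  push_cast
  ring

/-- The tail decreases in `m`, so the worst case is `m = d - 1`. There, with `d = n + 2`, the ratio
of the tail to `y = 1 - e` is at least `(1 - ne)(1 + (n+1)e) = 1 + e - n(n+1)e²`, which exceeds 1
for small `e`. -/
theorem exists_lt_binomialTail {d m : ℕ} (hm : m + 1 ≤ d) (hd : 2 ≤ d) :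
    ∃ y : ℝ, 0 < y ∧ y < 1 ∧ y < binomialTail d m y := by
  obtain ⟨n, rfl⟩ : ∃ n, d = n + 2 := ⟨d - 2, by omega⟩
  have hn : (0 : ℝ) ≤ n := Nat.cast_nonneg n
  set e : ℝ := 1 / (n + 2) ^ 2 with he
  have he0 : 0 < e := by positivity
  have he1 : e * (n + 2) ^ 2 = 1 := by rw [he]; field_simp
  have he2 : e < 1 := by nlinarith
  refine ⟨1 - e, by linarith, by linarith, ?_⟩
  refine lt_of_lt_of_le ?_ (binomialTail_antitone (n := n + 1) (by omega) (by linarith)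
    (by linarith))
  rw [binomialTail_pred]
  have hb : 1 - n * e ≤ (1 - e) ^ n := by
    have := one_add_mul_le_pow (a := -e) (by linarith) n
    simpa [sub_eq_add_neg] using this
  have h3 : (1 - n * e) * (1 + (n + 1) * e) ≤ (1 - e) ^ n * ((n + 2) - (n + 1) * (1 - e)) := by
    have : ((n : ℝ) + 2) - (n + 1) * (1 - e) = 1 + (n + 1) * e := by ring
    rw [this]
    exact mul_le_mul_of_nonneg_right hb (by positivity)
  have h4 : 1 < (1 - n * e) * (1 + (n + 1) * e) := by
    have : e * ((n : ℝ) * (n + 1)) < 1 := by nlinarith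
    nlinarith
  exact lt_mul_of_one_lt_right (by linarith) (h4.trans_le h3)

theorem criticalProbability_regularTree_pos {d k : ℕ} (hk : 2 ≤ k) (hkd : k ≤ d) :
    0 < criticalProbability (regularTree d) k := by
  obtain ⟨y, h0, h1, hy⟩ := exists_lt_binomialTail (d := d) (m := d + 1 - k) (by omega) (by omega)
  have ht : 0 < binomialTail d (d + 1 - k) y := h0.trans hy
  have hp : 0 < 1 - y / binomialTail d (d + 1 - k) y := by
    rw [sub_pos, div_lt_one ht]
    exact hy
  refine hp.trans_le (le_criticalProbability_regularTree (by omega) hk h0 h1.le ?_)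
  rw [branchMap, sub_sub_cancel, div_mul_cancel₀ _ ht.ne']

/-! ### The critical probability as a supremum -/

theorem isLUB_criticalProbability_regularTree {d k : ℕ} (hk : 2 ≤ k) (hkd : k ≤ d) :
    IsLUB ((fun p : I ↦ (p : ℝ)) '' {p : I | ∃ x : I, 0 < x ∧ x < 1 ∧
        (binomial d (σ x * σ p)).real (Set.Iic (d - k)) = (x : ℝ)})
      (criticalProbability (regularTree d) k) := by
  have hm : d - k + 1 = d + 1 - k := by omega
  simp only [binomial_real_Iic, hm, unitInterval.coe_symm_eq, Icc.coe_mul]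
  set m := d + 1 - k
  constructor
  · rintro _ ⟨p, ⟨x, hx0, hx1, hx⟩, rfl⟩
    have hx0' : (0 : ℝ) < x := hx0
    have hx1' : (x : ℝ) < 1 := hx1
    -- At `p = 1` the binomial parameter is 0 and `m ≥ 1`, so the equation would force `x = 1`.
    have hp : (0 : ℝ) < 1 - p := by
      refine (sub_nonneg.2 p.2.2).lt_of_ne fun hp ↦ ?_
      rw [← hp, mul_zero] at hx
      have : binomialTail d m 0 ≤ 0 := by
        have hm1 : (1 : ℝ) ≤ m := by exact_mod_cast (by omega : 1 ≤ d + 1 - k)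
        have := mul_binomialTail_le (d := d) (m := m) (by omega) le_rfl zero_le_one
        rw [mul_zero] at this
        by_contra! hlt
        nlinarith
      linarith
    refine le_criticalProbability_regularTree (y := (1 - x) * (1 - p)) (by omega) hk
      (mul_pos (sub_pos.2 hx1') hp) ?_ (le_of_eq ?_)
    · exact mul_le_one₀ (by linarith) hp.le (by linarith [p.2.1])
    · rw [branchMap]
      have : binomialTail d m ((1 - x) * (1 - p)) = 1 - x := by linarith
      rw [this, mul_comm]
  · intro b hb
    by_contra! hlt
    -- Positivity of the critical probability allows `p > 0`, which later makes the fixed point `z ≤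
    -- 1 - p` strictly less than 1.
    obtain ⟨p, hp1, hp2⟩ := exists_between (max_lt_iff.2
      ⟨hlt, (show (0 : ℝ) < criticalProbability (regularTree d) k from
        criticalProbability_regularTree_pos hk hkd)⟩)
    obtain ⟨hbp, hp0⟩ := max_lt_iff.1 hp1
    have hp3 : p < 1 := hp2.trans_le (criticalProbability_le_one _ _)
    have hex : ∃ y : ℝ, 0 < y ∧ y ≤ 1 ∧ y ≤ branchMap d m p y := by
      by_contra! hno
      exact hp2.not_ge (criticalProbability_regularTree_le hp0.le hp3.le hno)
    obtain ⟨y, hy0, hy1, hy⟩ := hex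
    have hle : ∀ z : ℝ, 0 ≤ z → z ≤ 1 → branchMap d m p z ≤ 1 - p := fun z hz0 hz1 ↦
      mul_le_of_le_one_right (by linarith) (binomialTail_le_one d m hz0 hz1)
    -- `f(y) ≥ y` and `f(1) ≤ 1` give a fixed point in `[y, 1]`; the root sought is then `x = 1 -
    -- binomialTail d m z`.
    obtain ⟨z, hz, hfix⟩ := intermediate_value_Icc' hy1
      ((continuous_branchMap d m p).sub continuous_id).continuousOn
      (show (0 : ℝ) ∈ _ from ⟨by simpa using (hle 1 zero_le_one le_rfl).trans (by linarith),
        by simpa using hy⟩)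
    have hfix : branchMap d m p z = z := by simpa [sub_eq_zero] using hfix
    have hz0 : 0 < z := hy0.trans_le hz.1
    have hz1 : z < 1 := by
      have := hle z hz0.le hz.2
      linarith
    have ht0 : 0 < binomialTail d m z := by
      refine (binomialTail_nonneg d m hz0.le hz1.le).lt_of_ne fun h ↦ hz0.ne ?_
      rw [← hfix, branchMap, ← h, mul_zero]
    have ht1 : binomialTail d m z < 1 := binomialTail_lt_one (by omega) hz0.le hz1
    refine hbp.not_ge (hb ⟨⟨p, hp0.le, hp3.le⟩,
      ⟨⟨1 - binomialTail d m z, by linarith, by linarith⟩, ?_, ?_, ?_⟩, rfl⟩)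
    · exact Subtype.mk_lt_mk.2 (by linarith)
    · exact Subtype.mk_lt_mk.2 (by linarith)
    · have : binomialTail d m z * (1 - p) = z := by rw [mul_comm]; exact hfix
      simp only [sub_sub_cancel]
      rw [this]

/-! ### Exact values for `k = d` and `k = 2` -/

theorem criticalProbability_regularTree_self {d : ℕ} (hd : 2 ≤ d) :
    criticalProbability (regularTree d) d = 1 - 1 / (d : ℝ) := by
  have hd0 : (2 : ℝ) ≤ d := by exact_mod_cast hd
  have hd1 : (d : ℝ) * (1 / d) = 1 := by field_simp
  have hd2 : (0 : ℝ) < 1 / d := by positivity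
  have hm : d + 1 - d = 1 := by omega
  refine le_antisymm (le_of_forall_gt_imp_ge_of_dense fun p hp ↦ ?_)
    (le_of_forall_lt_imp_le_of_dense fun p hp ↦ ?_)
  · rcases le_total 1 p with h1 | h1
    · exact (criticalProbability_le_one _ _).trans h1
    · refine criticalProbability_regularTree_le_of_lt (by nlinarith) h1 ?_
      rw [hm]
      push_cast
      nlinarith
  · rcases le_total p 0 with h0 | h0
    · exact h0.trans (criticalProbability_nonneg _ _)
    · set y : ℝ := 1 - p - 1 / d with hy
      have hy0 : 0 < y := by linarith
      have hy1 : y ≤ 1 := by linarith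
      refine le_criticalProbability_regularTree hd hd hy0 hy1 ?_
      rw [hm, branchMap, binomialTail_one]
      have hdy : (1 - p) * d = 1 + d * y := by rw [hy]; linarith
      -- Since `(1-p) d = 1 + d y`, this is exactly what `y ≤ f(y)` requires; it follows from
      -- Bernoulli's inequality and `(1 - y²)^d ≤ 1`.
      have h1 : (1 - y) ^ d * (1 + d * y) ≤ 1 := by
        have hb : 1 + d * y ≤ (1 + y) ^ d := one_add_mul_le_pow (by linarith) d
        calc (1 - y) ^ d * (1 + d * y) ≤ (1 - y) ^ d * (1 + y) ^ d :=
              mul_le_mul_of_nonneg_left hb (pow_nonneg (by linarith) d)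
          _ = (1 - y ^ 2) ^ d := by rw [← mul_pow]; ring
          _ ≤ 1 := pow_le_one₀ (by nlinarith) (by nlinarith)
      have h2 : d * y ≤ d * ((1 - p) * (1 - (1 - y) ^ d)) := by
        calc d * y ≤ (1 + d * y) * (1 - (1 - y) ^ d) := by linarith
          _ = _ := by rw [← hdy]; ring
      exact le_of_mul_le_mul_left h2 (by linarith)

/-- The maximisation for `k = 2`, rescaled so that the maximum is 1, attained at `t = 1`. -/
theorem pow_mul_sub_le_one (n : ℕ) {t : ℝ} (ht : 0 ≤ t) : t ^ n * ((n + 1) - n * t) ≤ 1 := by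
  induction n with
  | zero => simp
  | succ n ih =>
    have h : 0 ≤ (t - 1) * (t ^ (n + 1) - 1) := by
      rcases le_total t 1 with h | h
      · exact mul_nonneg_of_nonpos_of_nonpos (by linarith)
          (by linarith [pow_le_one₀ (n := n + 1) ht h])
      · exact mul_nonneg (by linarith) (by linarith [one_le_pow₀ (n := n + 1) h])
    have h2 := mul_le_mul_of_nonneg_left ih ht
    push_cast
    rw [pow_succ] at h ⊢
    linarith

theorem criticalProbability_regularTree_two {d : ℕ} (hd : 2 ≤ d) :
    criticalProbability (regularTree d) 2 =
      1 - ((d : ℝ) - 1) ^ (2 * d - 3) / ((d : ℝ) ^ (d - 1) * ((d : ℝ) - 2) ^ (d - 2)) := by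
  obtain ⟨n, rfl⟩ : ∃ n, d = n + 2 := ⟨d - 2, by omega⟩
  -- For `d = 2` the maximiser below degenerates to 0, but there `k = d`.
  rcases Nat.eq_zero_or_pos n with rfl | hn
  · rw [zero_add, criticalProbability_regularTree_self le_rfl]
    norm_num
  rw [show 2 * (n + 2) - 3 = 2 * n + 1 by omega, show n + 2 - 1 = n + 1 by omega,
    show n + 2 - 2 = n by omega]
  have hm : n + 2 + 1 - 2 = n + 1 := by omega
  push_cast
  rw [show (n : ℝ) + 2 - 1 = n + 1 by ring, add_sub_cancel_right]
  have hn0 : (0 : ℝ) < n := by exact_mod_cast hn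
  -- The critical point of `z ^ n * ((n + 2) - (n + 1) * z)`, the tail divided by `z`. Its maximum
  -- is `M`, so the threshold is `(1-p) M = 1`.
  set y : ℝ := (n + 2) * n / (n + 1) ^ 2 with hy
  have hy0 : 0 < y := by positivity
  have hy1 : y ≤ 1 := by
    rw [hy, div_le_one (by positivity)]
    nlinarith
  set M : ℝ := y ^ n * ((n + 2) / (n + 1)) with hM
  have hM0 : 0 < M := by positivity
  have hMinv : ((n : ℝ) + 1) ^ (2 * n + 1) / ((n + 2) ^ (n + 1) * n ^ n) = 1 / M := by
    rw [hM, hy, div_pow, mul_pow, ← pow_mul]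
    field_simp
    ring
  have hscale : ∀ t : ℝ, (y * t) ^ n * ((n + 2) - (n + 1) * (y * t)) =
      M * (t ^ n * ((n + 1) - n * t)) := by
    intro t
    have : ((n : ℝ) + 2) - (n + 1) * (y * t) = (n + 2) / (n + 1) * ((n + 1) - n * t) := by
      rw [hy]
      field_simp
    rw [this, hM, mul_pow]
    ring
  have hmax : ∀ z : ℝ, 0 < z → z ^ n * ((n + 2) - (n + 1) * z) ≤ M := by
    intro z hz
    have h := hscale (z / y)
    rw [mul_div_cancel₀ _ hy0.ne'] at h
    rw [h]
    exact mul_le_of_le_one_right hM0.le (pow_mul_sub_le_one n (by positivity))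
  have hatt : y ^ n * ((n + 2) - (n + 1) * y) = M := by
    have h := hscale 1
    simpa using h
  rw [hMinv]
  refine le_antisymm (le_of_forall_gt_imp_ge_of_dense fun p hp ↦ ?_) ?_
  · rcases le_total 1 p with h1 | h1
    · exact (criticalProbability_le_one _ _).trans h1
    · have hM1 : 1 ≤ M := by
        have := hmax 1 one_pos
        rw [one_pow] at this
        linarith
      have hp0 : 0 ≤ p := by
        have : 1 / M ≤ 1 := (div_le_one hM0).2 hM1
        linarith
      refine criticalProbability_regularTree_le hp0 h1 fun z hz0 hz1 ↦ ?_
      rw [hm, branchMap, binomialTail_pred, mul_left_comm]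
      refine mul_lt_of_lt_one_right hz0 ?_
      refine (mul_le_mul_of_nonneg_left (hmax z hz0) (by linarith)).trans_lt ?_
      rw [← lt_div_iff₀ hM0]
      linarith
  · refine le_criticalProbability_regularTree (by omega) le_rfl hy0 hy1 ?_
    rw [hm, branchMap, binomialTail_pred, mul_left_comm, hatt, sub_sub_cancel,
      one_div_mul_cancel hM0.ne', mul_one]

/-! ### Asymptotics for `k = 2` -/

theorem one_sub_pow_le (n : ℕ) {u : ℝ} (h0 : 0 ≤ u) (h1 : u ≤ 1) :
    (1 - u) ^ n ≤ 1 - n * u + n * (n - 1) / 2 * u ^ 2 := by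
  induction n with
  | zero => simp
  | succ n ih =>
    have h := mul_le_mul_of_nonneg_right ih (sub_nonneg.2 h1)
    have h2 : 0 ≤ (n : ℝ) * (n - 1) := by
      rcases Nat.eq_zero_or_pos n with rfl | hn
      · simp
      · have : (1 : ℝ) ≤ n := by exact_mod_cast hn
        exact mul_nonneg (by linarith) (by linarith)
    have h3 : 0 ≤ (n : ℝ) * (n - 1) * u ^ 3 := mul_nonneg h2 (pow_nonneg h0 3)
    rw [pow_succ (1 - u) n]
    push_cast
    linarith

theorem le_one_sub_pow (n : ℕ) {u : ℝ} (h0 : 0 ≤ u) (h1 : u ≤ 1) :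
    1 - n * u + n * (n - 1) / 2 * u ^ 2 - n * (n - 1) * (n - 2) / 6 * u ^ 3 ≤ (1 - u) ^ n := by
  induction n with
  | zero => simp
  | succ n ih =>
    have h := mul_le_mul_of_nonneg_right ih (sub_nonneg.2 h1)
    have h2 : 0 ≤ (n : ℝ) * (n - 1) * (n - 2) := by
      rcases n with _ | _ | n
      · simp
      · simp
      · push_cast
        rw [show (n : ℝ) + 1 + 1 - 1 = n + 1 by ring, show (n : ℝ) + 1 + 1 - 2 = n by ring]
        positivity
    have h3 : 0 ≤ (n : ℝ) * (n - 1) * (n - 2) * u ^ 4 := mul_nonneg h2 (pow_nonneg h0 4)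
    rw [pow_succ (1 - u) n]
    push_cast
    linarith

/-- With `n = d - 1` and `D = (1 - 1/n²)^n`, the closed form is `1 - (1 - 1/n)/D`. Thus `1 - 1/n`
cancels in the numerator, leaving the second-order term of `D`. -/
theorem criticalProbability_regularTree_two_eq {n : ℕ} (hn : 2 ≤ n) :
    criticalProbability (regularTree (n + 1)) 2 =
      ((1 - 1 / (n : ℝ) ^ 2) ^ n - 1 + 1 / n) / (1 - 1 / (n : ℝ) ^ 2) ^ n := by
  obtain ⟨j, rfl⟩ : ∃ j, n = j + 1 := ⟨n - 1, by omega⟩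
  have hj : (0 : ℝ) < j := by exact_mod_cast (by omega : 0 < j)
  rw [criticalProbability_regularTree_two (by omega), show 2 * (j + 1 + 1) - 3 = 2 * j + 1 by omega,
    show j + 1 + 1 - 1 = j + 1 by omega, show j + 1 + 1 - 2 = j by omega]
  push_cast
  have hD : (1 - 1 / ((j : ℝ) + 1) ^ 2) ^ (j + 1) =
      j ^ (j + 1) * (j + 2) ^ (j + 1) / (j + 1) ^ (2 * j + 2) := by
    rw [← mul_pow, show 2 * j + 2 = 2 * (j + 1) by ring, pow_mul, ← div_pow]
    congr 1
    field_simp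
    ring
  have hD0 : (0 : ℝ) < j ^ (j + 1) * (j + 2) ^ (j + 1) / (j + 1) ^ (2 * j + 2) := by positivity
  rw [hD, show ∀ D : ℝ, D - 1 + 1 / ((j : ℝ) + 1) = D - (1 - 1 / (j + 1)) by intro D; ring,
    sub_div, div_self hD0.ne', show (j : ℝ) + 1 + 1 - 1 = j + 1 by ring,
    show (j : ℝ) + 1 + 1 = j + 2 by ring, add_sub_cancel_right,
    show 1 - 1 / ((j : ℝ) + 1) = j / (j + 1) by field_simp; ring]
  congr 1
  field_simp
  ring

theorem criticalProbability_regularTree_two_isEquivalent :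
    (fun d : ℕ ↦ criticalProbability (regularTree d) 2) ~[atTop]
      (fun d : ℕ ↦ 1 / (2 * (d : ℝ) ^ 2)) := by
  have hinv : Tendsto (fun n : ℕ ↦ (1 : ℝ) / n) atTop (𝓝 0) := tendsto_one_div_atTop_nhds_zero_nat
  have hu0 : ∀ n : ℕ, (0 : ℝ) ≤ 1 / (n : ℝ) ^ 2 := fun n ↦ by positivity
  have hu1 : ∀ n : ℕ, 1 ≤ n → 1 / (n : ℝ) ^ 2 ≤ 1 := fun n hn ↦ by
    have : (1 : ℝ) ≤ n := by exact_mod_cast hn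
    rw [div_le_one (by positivity)]
    exact one_le_pow₀ this
  -- Truncated binomial expansions at `u = 1/n²` squeeze the numerator around `1/(2n²)`.
  have hD : Tendsto (fun n : ℕ ↦ 2 * (n : ℝ) ^ 2 * ((1 - 1 / (n : ℝ) ^ 2) ^ n - 1 + 1 / n))
      atTop (𝓝 1) := by
    have hlow : Tendsto (fun n : ℕ ↦ 1 - (1 : ℝ) / n - 1 / n * (1 / 3)) atTop (𝓝 1) := by
      have h := ((tendsto_const_nhds (x := (1 : ℝ))).sub hinv).sub (hinv.mul_const (1 / 3))
      rwa [zero_mul, sub_zero, sub_zero] at h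
    have hupp : Tendsto (fun n : ℕ ↦ 1 - (1 : ℝ) / n) atTop (𝓝 1) := by
      simpa using (tendsto_const_nhds (x := (1 : ℝ))).sub hinv
    refine tendsto_of_tendsto_of_tendsto_of_le_of_le' hlow hupp ?_ ?_
    · filter_upwards [eventually_ge_atTop 1] with n hn
      have hn1 : (1 : ℝ) ≤ n := by exact_mod_cast hn
      have h := le_one_sub_pow n (hu0 n) (hu1 n hn)
      have h2 : 2 * (n : ℝ) ^ 2 * ((1 - n * (1 / (n : ℝ) ^ 2) + n * (n - 1) / 2 * (1 / (n : ℝ) ^ 2) ^ 2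
          - n * (n - 1) * (n - 2) / 6 * (1 / (n : ℝ) ^ 2) ^ 3) - 1 + 1 / n) =
          1 - 1 / n - 1 / n * (1 / 3) * (((n : ℝ) - 1) * (n - 2) / n ^ 2) := by
        field_simp
        ring
      have h3 : ((n : ℝ) - 1) * (n - 2) / n ^ 2 ≤ 1 := by
        rw [div_le_one (by positivity)]
        nlinarith
      have h4 : 1 / (n : ℝ) * (1 / 3) * (((n : ℝ) - 1) * (n - 2) / n ^ 2) ≤ 1 / n * (1 / 3) :=
        mul_le_of_le_one_right (by positivity) h3
      calc _ ≤ 1 - 1 / (n : ℝ) - 1 / n * (1 / 3) * (((n : ℝ) - 1) * (n - 2) / n ^ 2) := by linarith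
        _ ≤ _ := by
          rw [← h2]
          exact mul_le_mul_of_nonneg_left (by linarith) (by positivity)
    · filter_upwards [eventually_ge_atTop 1] with n hn
      have hn1 : (1 : ℝ) ≤ n := by exact_mod_cast hn
      have h := one_sub_pow_le n (hu0 n) (hu1 n hn)
      have h2 : 2 * (n : ℝ) ^ 2 * ((1 - n * (1 / (n : ℝ) ^ 2) + n * (n - 1) / 2 *
          (1 / (n : ℝ) ^ 2) ^ 2) - 1 + 1 / n) = 1 - 1 / n := by
        field_simp
        ring
      rw [← h2]
      exact mul_le_mul_of_nonneg_left (by linarith) (by positivity)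
  have hP : Tendsto (fun n : ℕ ↦ (1 - 1 / (n : ℝ) ^ 2) ^ n) atTop (𝓝 1) := by
    have h := ((hD.mul (hinv.pow 2)).mul_const (1 / 2)).add
      ((tendsto_const_nhds (x := (1 : ℝ))).sub hinv)
    simp only [ne_eq, OfNat.ofNat_ne_zero, not_false_eq_true, zero_pow, mul_zero, zero_mul,
      zero_add, sub_zero] at h
    refine h.congr' ?_
    filter_upwards [eventually_ge_atTop 1] with n hn
    have hn1 : (n : ℝ) ≠ 0 := by positivity
    field_simp
    ring
  -- This factor `(d/n)²` compensates for the shift `d = n + 1`.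
  have hR : Tendsto (fun n : ℕ ↦ (1 + (1 : ℝ) / n) ^ 2) atTop (𝓝 1) := by
    simpa using ((tendsto_const_nhds (x := (1 : ℝ))).add hinv).pow 2
  rw [isEquivalent_iff_tendsto_one]
  · rw [← tendsto_add_atTop_iff_nat 1]
    have h := (hD.div hP one_ne_zero).mul hR
    rw [div_one, mul_one] at h
    refine h.congr' ?_
    filter_upwards [eventually_ge_atTop 2] with n hn
    have hn1 : (n : ℝ) ≠ 0 := by positivity
    simp only [Pi.div_apply]
    rw [criticalProbability_regularTree_two_eq hn]
    push_cast
    generalize (1 - 1 / (n : ℝ) ^ 2) ^ n = D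
    field_simp
  · filter_upwards [eventually_ge_atTop 1] with d hd
    positivity

/-! ### The limit when `k_d / d` converges -/

theorem tendsto_criticalProbability_regularTree {γ : ℝ} (hγ : γ ∈ Icc (0 : ℝ) 1) {k : ℕ → ℕ}
    (hk : Tendsto (fun d : ℕ ↦ (k d : ℝ) / (d : ℝ)) atTop (𝓝 γ)) :
    Tendsto (fun d : ℕ ↦ criticalProbability (regularTree d) (k d)) atTop (𝓝 γ) := by
  refine tendsto_order.2 ⟨fun a ha ↦ ?_, fun a ha ↦ ?_⟩
  · rcases lt_or_ge a 0 with ha0 | ha0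
    · exact Eventually.of_forall fun d ↦ ha0.trans_le (criticalProbability_nonneg _ _)
    obtain ⟨p, hap, hpγ⟩ := exists_between ha
    obtain ⟨b, hpb, hbγ⟩ := exists_between hpγ
    obtain ⟨c, hbc, hcγ⟩ := exists_between hbγ
    have hp0 : 0 < p := ha0.trans_lt hap
    have hγ1 := hγ.2
    have hev : Tendsto (fun d : ℕ ↦ (d : ℝ) * (1 - (1 - b) / (1 - p)) * (c - b) ^ 2) atTop atTop := by
      refine Tendsto.atTop_mul_const (by nlinarith) (Tendsto.atTop_mul_const ?_
        tendsto_natCast_atTop_atTop)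
      rw [sub_pos, div_lt_one (by linarith)]
      linarith
    have hev2 : Tendsto (fun d : ℕ ↦ (d : ℝ) * (c - b)) atTop atTop :=
      Tendsto.atTop_mul_const (by linarith) tendsto_natCast_atTop_atTop
    have hev3 : Tendsto (fun d : ℕ ↦ (d : ℝ) * c) atTop atTop :=
      Tendsto.atTop_mul_const (by linarith) tendsto_natCast_atTop_atTop
    filter_upwards [hk.eventually_const_lt hcγ, hev.eventually_ge_atTop 4,
      hev2.eventually_ge_atTop 2, hev3.eventually_ge_atTop 2, eventually_ge_atTop 2]
      with d h1 h2 h3 h4 hd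
    have hd0 : (0 : ℝ) < d := by positivity
    rw [lt_div_iff₀ hd0] at h1
    have hk2 : 2 ≤ k d := by
      have : (2 : ℝ) ≤ k d := by linarith
      exact_mod_cast this
    -- At `y = 1 - b` the binomial mean `d(1-b)` exceeds `m`, which is about `d(1-γ)`, by order `d`.
    -- Chebyshev sends the tail to 1, so it eventually exceeds `(1-b)/(1-p) < 1`.
    refine hap.trans_le (le_criticalProbability_regularTree hd hk2 (y := 1 - b) (by linarith)
      (by linarith) ?_)
    -- Halving absorbs the `+1` in `m`; if `k d > d + 1`, truncated subtraction makes `m = 0`.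
    have hgap : (d : ℝ) * (c - b) / 2 ≤ d * (1 - b) - (d + 1 - k d : ℕ) := by
      rcases le_total (k d) (d + 1) with hkd | hkd
      · rw [Nat.cast_sub hkd]
        push_cast
        linarith
      · rw [Nat.sub_eq_zero_of_le hkd, Nat.cast_zero]
        nlinarith
    set m := d + 1 - k d
    have hch := sq_mul_one_sub_binomialTail_le (d := d) (m := m) (y := 1 - b) (by linarith)
      (by linarith) (by linarith)
    have ht := binomialTail_le_one d m (y := 1 - b) (by linarith) (by linarith)
    have hsq : (d * (c - b) / 2) ^ 2 ≤ (d * (1 - b) - m) ^ 2 :=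
      pow_le_pow_left₀ (by positivity) hgap 2
    have hS : 1 - binomialTail d m (1 - b) ≤ 1 - (1 - b) / (1 - p) := by
      have h5 := (mul_le_mul_of_nonneg_right hsq (sub_nonneg.2 ht)).trans hch
      have h6 : d * ((c - b) ^ 2 * (1 - binomialTail d m (1 - b))) ≤ 4 := by
        refine le_of_mul_le_mul_left ?_ hd0
        linarith
      have h7 : (0 : ℝ) < d * (c - b) ^ 2 := mul_pos hd0 (pow_pos (by linarith) 2)
      refine le_of_mul_le_mul_left ?_ h7
      linarith
    have hfrac : (1 - p) * ((1 - b) / (1 - p)) = 1 - b := mul_div_cancel₀ _ (by linarith)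
    calc 1 - b = (1 - p) * ((1 - b) / (1 - p)) := hfrac.symm
      _ ≤ branchMap d m p (1 - b) := mul_le_mul_of_nonneg_left (by linarith) (by linarith)
  · rcases lt_or_ge 1 a with ha1 | ha1
    · exact Eventually.of_forall fun d ↦ (criticalProbability_le_one _ _).trans_lt ha1
    obtain ⟨p, hγp, hpa⟩ := exists_between ha
    filter_upwards [hk.eventually_lt_const hγp, eventually_ge_atTop 1] with d h1 hd
    have hd0 : (0 : ℝ) < d := by positivity
    have hγ0 := hγ.1
    refine lt_of_le_of_lt ?_ hpa
    rw [div_lt_iff₀ hd0] at h1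
    refine criticalProbability_regularTree_le_of_lt (by linarith) (by linarith) ?_
    have hkd : k d ≤ d + 1 := by
      have : (k d : ℝ) ≤ d + 1 := by nlinarith
      exact_mod_cast this
    rw [Nat.cast_sub hkd]
    push_cast
    linarith

theorem proposition1p2 :
    (∀ d k : ℕ, 2 ≤ k → k ≤ d →
      IsLUB ((fun p : I ↦ (p : ℝ)) '' {p : I | ∃ x : I, 0 < x ∧ x < 1 ∧
          (binomial d (σ x * σ p)).real (Set.Iic (d - k)) = (x : ℝ)})
        (criticalProbability (regularTree d) k)) ∧
    (∀ γ : ℝ, γ ∈ Set.Icc (0 : ℝ) 1 → ∀ k : ℕ → ℕ,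
      Tendsto (fun d : ℕ ↦ (k d : ℝ) / (d : ℝ)) atTop (𝓝 γ) →
      Tendsto (fun d : ℕ ↦ criticalProbability (regularTree d) (k d)) atTop (𝓝 γ)) ∧
    (∀ d : ℕ, 2 ≤ d → criticalProbability (regularTree d) d = 1 - 1 / (d : ℝ)) ∧
    (∀ d : ℕ, 2 ≤ d → criticalProbability (regularTree d) 2 =
      1 - ((d : ℝ) - 1) ^ (2 * d - 3) / ((d : ℝ) ^ (d - 1) * ((d : ℝ) - 2) ^ (d - 2))) ∧
    (fun d : ℕ ↦ criticalProbability (regularTree d) 2) ~[atTop]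
      (fun d : ℕ ↦ 1 / (2 * (d : ℝ) ^ 2)) :=
  ⟨fun _ _ ↦ isLUB_criticalProbability_regularTree,
    fun _ hγ _ ↦ tendsto_criticalProbability_regularTree hγ,
    fun _ ↦ criticalProbability_regularTree_self,
    fun _ ↦ criticalProbability_regularTree_two,
    criticalProbability_regularTree_two_isEquivalent⟩
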